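/- Let $\Bbbk$ be a field of characteristic zero and $H=\Bbbk[D]$. A conformal algebra $C$ is a unital left $H$-module with $\Bbbk$-bilinear operations $(\cdot\,{}_{(n)}\,\cdot)$, $n\ge 0$, such that for all $a,b\in C$ one has $a_{(n)}b=0$ for all sufficiently large $n$, and, for all $n\ge 0$, $Da_{(n)}b=-n\,a_{(n-1)}b$ and $a_{(n)}Db=D(a_{(n)}b)+n\,a_{(n-1)}b$ (terms with factor $n=0$ are zero). Its coefficient algebra $\operatorname{Coeff}C$ is the space $\Bbbk[t,t^{-1}]\otimes_H C$, where $t^nD=-nt^{n-1}$, with the bilinear multiplication determined, for $a(n)=t^n\otimes_H a$, by $$a(n)\,b(m)=\sum_{s\ge 0}\binom{n}{s}(a_{(s)}b)(n+m-s),\qquad a,b\in C,\ n,m\in\mathbb Z .$$ Let $\Delta^{(n)}:H\to H^{\otimes n}$ be the iterated coproduct, i.e. the algebra homomorphism with $\Delta^{(n)}(D)=\sum_{i=1}^n 1\otimes\dots\otimes D\otimes\dots\otimes 1$ ($D$ in position $i$), and let $h\in H$ act on $H^{\otimes n}$ by multiplication by $\Delta^{(n)}(h)$. The pseudoproduct on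 $C$ is $$a*b=\sum_{s\ge 0}\Big(\frac{(-D)^s}{s!}\otimes 1\Big)\otimes_H (a_{(s)}b)\in (H\otimes H)\otimes_H C,$$ and the expanded pseudoproduct $(H^{\otimes n}\otimes_H C)\otimes(H^{\otimes m}\otimes_H C)\to H^{\otimes(n+m)}\otimes_H C$ is $$(F\otimes_H a)*(G\otimes_H b)=(F\otimes G\otimes_H 1)\,(\Delta^{(n)}\otimes\Delta^{(m)}\otimes_H \mathrm{id}_C)(a*b).$$ Let $$f(a_1,\dots,a_n)=\sum_{\sigma\in\mathbb S_n}t_\sigma(a_{1\sigma},\dots,a_{n\sigma})$$ be a homogeneous multilinear non-associative polynomial over $\Bbbk$, where each $t_\sigma(b_1,\dots,b_n)$ is a linear combination of bracketings of the word $b_1\cdots b_n$. For $a_1,\dots,a_n\in C$ let $t_\sigma^*(b_1,\dots,b_n)\in H^{\otimes n}\otimes_H C$ be obtained from $t_\sigma$ by replacing the multiplication with the expanded pseudoproduct (each $b\in C$ being identified with $1\otimes_H b\in H\otimes_H C$), and put $$f^*(a_1,\dots,a_n)=\sum_{\sigma\in\mathbb S_n}(\sigma\otimes_H\mathrm{id}_C)\,t_\sigma^*(a_{1\sigma},\dots,a_{n\sigma})\in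 H^{\otimes n}\otimes_H C,$$ where $\sigma$ acts on $H^{\otimes n}$ by moving the $i$-th tensor factor to position $i\sigma$. **Theorem.** Let $C$ be a conformal algebra. If $C$ as a pseudoalgebra satisfies the pseudo-identity $f^*=0$ (that is, $f^*(a_1,\dots,a_n)=0$ for all $a_1,\dots,a_n\in C$), then $\operatorname{Coeff}C$ satisfies the identity $f=0$ (that is, $f(u_1,\dots,u_n)=0$ for all $u_1,\dots,u_n\in\operatorname{Coeff}C$). -/

import Mathlib

open scoped Polynomial TensorProduct LaurentPolynomial

set_option linter.unusedSectionVars false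

noncomputable section

/-! ### Conformal algebras -/

/-- A conformal algebra over a field `k` of characteristic zero. Here `k[X]` is the polynomial
algebra in one variable `X`, which plays the role of `D`. For `n = 0` the terms with the factor `n`
vanish, so the value of `n - 1` is irrelevant there. -/
class ConformalAlgebra (k C : Type*) [Field k] [CharZero k] [AddCommGroup C] [Module k C]
    [Module k[X] C] [IsScalarTower k k[X] C] where
  /-- the family of bilinear operations `(a, b) ↦ a ₍ₙ₎ b` -/
  nprod : ℕ → C →ₗ[k] C →ₗ[k] C
  locality : ∀ a b : C, ∃ N : ℕ, ∀ n : ℕ, N ≤ n → nprod n a b = 0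
  D_nprod : ∀ (n : ℕ) (a b : C),
    nprod n ((Polynomial.X : k[X]) • a) b = -((n : k) • nprod (n - 1) a b)
  nprod_D : ∀ (n : ℕ) (a b : C),
    nprod n a ((Polynomial.X : k[X]) • b)
      = (Polynomial.X : k[X]) • nprod n a b + (n : k) • nprod (n - 1) a b

namespace ConformalAlgebra

/-- A biadditive map that is balanced for `X` and for scalars is balanced for all of `k[X]`. -/
theorem balanced_of_X {k M N P : Type*} [Field k] [AddCommGroup M] [AddCommGroup N]
    [AddCommGroup P] [Module k M] [Module k N] [Module k[X] M] [Module k[X] N]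
    [IsScalarTower k k[X] M] [IsScalarTower k k[X] N]
    (f : M →+ N →+ P) (hC : ∀ (c : k) m n, f (c • m) n = f m (c • n))
    (hX : ∀ m n, f ((Polynomial.X : k[X]) • m) n = f m ((Polynomial.X : k[X]) • n))
    (h : k[X]) (m : M) (n : N) : f (h • m) n = f m (h • n) := by
  induction h using Polynomial.induction_on generalizing m n with
  | C c => simpa [← Polynomial.smul_eq_C_mul, ← algebraMap_smul k[X] c] using hC c m n
  | add p q hp hq => simp [add_smul, hp, hq]
  | monomial j c ih =>
    rw [pow_succ, ← mul_assoc, mul_smul, ih, hX, smul_smul, mul_comm]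

/-! ### The coefficient algebra -/

section Laurent

variable (k : Type*) [Field k] [CharZero k]

/-- The linear map on Laurent polynomials with `t ^ n ↦ binom(n, s) t ^ (n - s)`, where
`binom(n, s) = n (n - 1) ⋯ (n - s + 1) / s!` for every integer `n`. -/
def laurentHasse (s : ℕ) : k[T;T⁻¹] →ₗ[k] k[T;T⁻¹] :=
  (AddMonoidAlgebra.basis ℤ k).constr k
    fun n : ℤ => ((Ring.choose n s : ℤ) : k) • (LaurentPolynomial.T (n - s) : k[T;T⁻¹])

/-- The linear map on Laurent polynomials with `t ^ n ↦ -n t ^ (n - 1)`. -/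
def laurentD : k[T;T⁻¹] →ₗ[k] k[T;T⁻¹] :=
  (AddMonoidAlgebra.basis ℤ k).constr k
    fun n : ℤ => (-(n : k)) • (LaurentPolynomial.T (n - 1) : k[T;T⁻¹])

/-- The space `k[t, t⁻¹]` as a module over `k[D]`, with `t ^ n D = -n t ^ (n - 1)`. -/
abbrev LaurentMod : Type _ := Module.AEval' (laurentD k)

variable {k}

theorem laurentHasse_T (s : ℕ) (n : ℤ) :
    laurentHasse k s (LaurentPolynomial.T n)
      = ((Ring.choose n s : ℤ) : k) • (LaurentPolynomial.T (n - s) : k[T;T⁻¹]) := by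
  have := (AddMonoidAlgebra.basis ℤ k).constr_basis k
    (fun n : ℤ => ((Ring.choose n s : ℤ) : k) • (LaurentPolynomial.T (n - s) : k[T;T⁻¹])) n
  rwa [AddMonoidAlgebra.basis_apply] at this

theorem laurentD_T (n : ℤ) :
    laurentD k (LaurentPolynomial.T n)
      = (-(n : k)) • (LaurentPolynomial.T (n - 1) : k[T;T⁻¹]) := by
  have := (AddMonoidAlgebra.basis ℤ k).constr_basis k
    (fun n : ℤ => (-(n : k)) • (LaurentPolynomial.T (n - 1) : k[T;T⁻¹])) n
  rwa [AddMonoidAlgebra.basis_apply] at this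

theorem laurent_hom_ext {M : Type*} [AddCommGroup M] [Module k M] {f g : k[T;T⁻¹] →ₗ[k] M}
    (h : ∀ n : ℤ, f (LaurentPolynomial.T n) = g (LaurentPolynomial.T n)) : f = g :=
  (AddMonoidAlgebra.basis ℤ k).ext fun n => by
    rw [AddMonoidAlgebra.basis_apply]; exact h n

theorem choose_succ_mul (n : ℤ) (s : ℕ) :
    ((s : ℤ) + 1) * Ring.choose n (s + 1) = n * Ring.choose (n - 1) s := by
  have h := Ring.choose_smul_choose n (n := s + 1) (k := 1) (by omega)
  simpa [Ring.choose_one_right] using h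

theorem choose_succ_mul' (n : ℤ) (s : ℕ) :
    ((s : ℤ) + 1) * Ring.choose n (s + 1) = (n - s) * Ring.choose n s := by
  have h := Ring.choose_smul_choose n (n := s + 1) (k := s) (by omega)
  have h2 : s + 1 - s = 1 := by omega
  rw [h2, Ring.choose_one_right] at h
  simp only [Nat.choose_succ_self_right, nsmul_eq_mul] at h
  push_cast at h
  linarith

theorem hasse_zero (x : k[T;T⁻¹]) : laurentHasse k 0 x = x := by
  have : laurentHasse k 0 = LinearMap.id := laurent_hom_ext fun n => by simp [laurentHasse_T]
  rw [this]; rfl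

theorem hasse_D (s : ℕ) (x : k[T;T⁻¹]) :
    laurentHasse k s (laurentD k x) = -(((s : k) + 1) • laurentHasse k (s + 1) x) := by
  have : laurentHasse k s ∘ₗ laurentD k = -(((s : k) + 1) • laurentHasse k (s + 1)) := by
    refine laurent_hom_ext fun n => ?_
    have h := congrArg (Int.cast : ℤ → k) (choose_succ_mul n s)
    push_cast at h
    simp only [LinearMap.comp_apply, laurentD_T, map_smul, map_neg, laurentHasse_T,
      LinearMap.neg_apply, LinearMap.smul_apply, smul_smul, h, neg_smul]
    congr 3
    push_cast; ring
  exact LinearMap.congr_fun this x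

theorem D_hasse (s : ℕ) (x : k[T;T⁻¹]) :
    laurentD k (laurentHasse k s x) = -(((s : k) + 1) • laurentHasse k (s + 1) x) := by
  have : laurentD k ∘ₗ laurentHasse k s = -(((s : k) + 1) • laurentHasse k (s + 1)) := by
    refine laurent_hom_ext fun n => ?_
    have h := congrArg (Int.cast : ℤ → k) (choose_succ_mul' n s)
    push_cast at h
    simp only [LinearMap.comp_apply, laurentD_T, map_smul, laurentHasse_T, LinearMap.neg_apply,
      LinearMap.smul_apply, smul_smul, h]
    rw [← neg_smul]
    congr 2
    · push_cast; ring
    · push_cast; ring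
  exact LinearMap.congr_fun this x

theorem D_mul (x y : k[T;T⁻¹]) :
    laurentD k (x * y) = laurentD k x * y + x * laurentD k y := by
  have : (LinearMap.mul k k[T;T⁻¹]).compr₂ (laurentD k)
      = (LinearMap.mul k k[T;T⁻¹]).comp (laurentD k)
        + (LinearMap.mul k k[T;T⁻¹]).compl₂ (laurentD k) := by
    refine laurent_hom_ext fun n => laurent_hom_ext fun m => ?_
    simp only [LinearMap.compr₂_apply, LinearMap.mul_apply', LinearMap.add_apply,
      LinearMap.comp_apply, LinearMap.compl₂_apply, laurentD_T, ← LaurentPolynomial.T_add,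
      smul_mul_assoc, mul_smul_comm]
    rw [show n - 1 + m = n + m - 1 by ring, show n + (m - 1) = n + m - 1 by ring, ← add_smul]
    congr 1
    push_cast; ring
  exact LinearMap.congr_fun (LinearMap.congr_fun this x) y

end Laurent

section Coeff

variable (k C : Type*) [Field k] [CharZero k] [AddCommGroup C] [Module k C]
    [Module k[X] C] [IsScalarTower k k[X] C]

/-- The underlying space `k[t, t⁻¹] ⊗_H C`, `H = k[D]`, of the coefficient algebra of `C`. -/
def Coeff : Type _ := LaurentMod k ⊗[k[X]] C

instance : AddCommGroup (Coeff k C) := inferInstanceAs (AddCommGroup (LaurentMod k ⊗[k[X]] C))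

instance : Module k (Coeff k C) := inferInstanceAs (Module k (LaurentMod k ⊗[k[X]] C))

variable {k C}

/-- The element `a(x) = x ⊗_H a`; in particular `a(n) = t ^ n ⊗_H a`. -/
def coeff (x : k[T;T⁻¹]) (a : C) : Coeff k C :=
  (Module.AEval'.of (laurentD k) x : LaurentMod k) ⊗ₜ[k[X]] a

theorem coeff_add_left (x y : k[T;T⁻¹]) (a : C) : coeff (x + y) a = coeff x a + coeff y a := by
  rw [coeff, map_add]; exact TensorProduct.add_tmul _ _ _

theorem coeff_add_right (x : k[T;T⁻¹]) (a b : C) : coeff x (a + b) = coeff x a + coeff x b :=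
  TensorProduct.tmul_add _ _ _

theorem coeff_zero_right (x : k[T;T⁻¹]) : coeff x (0 : C) = 0 := TensorProduct.tmul_zero _ _

theorem coeff_smul_left (c : k) (x : k[T;T⁻¹]) (a : C) : coeff (c • x) a = c • coeff x a := by
  rw [coeff, map_smul]; rfl

theorem coeff_smul_right (c : k) (x : k[T;T⁻¹]) (a : C) : coeff x (c • a) = c • coeff x a := by
  rw [← coeff_smul_left, coeff, coeff, map_smul, ← algebraMap_smul k[X] c a,
    ← algebraMap_smul k[X] c (Module.AEval'.of (laurentD k) x), TensorProduct.smul_tmul]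

theorem coeff_D (x : k[T;T⁻¹]) (a : C) :
    coeff x ((Polynomial.X : k[X]) • a) = coeff (laurentD k x) a := by
  rw [coeff, coeff, ← TensorProduct.smul_tmul, Module.AEval'.X_smul_of]

@[elab_as_elim]
theorem coeff_induction {p : Coeff k C → Prop} (u : Coeff k C) (h0 : p 0)
    (h1 : ∀ x a, p (coeff x a)) (h2 : ∀ u v, p u → p v → p (u + v)) : p u :=
  TensorProduct.induction_on (motive := p) u h0
    (fun x a => h1 ((Module.AEval'.of (laurentD k)).symm x) a) h2

theorem coeff_addHom_ext {P : Type*} [AddCommGroup P] {f g : Coeff k C →+ P}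
    (h : ∀ x a, f (coeff x a) = g (coeff x a)) : f = g := by
  ext u
  induction u using coeff_induction with
  | h0 => simp
  | h1 x a => exact h x a
  | h2 u v hu hv => simp [hu, hv]

/-- Construct an additive map out of the coefficient algebra from a balanced biadditive map. -/
def coeffLift {P : Type*} [AddCommGroup P] (f : k[T;T⁻¹] →+ C →+ P)
    (hC : ∀ (c : k) x a, f (c • x) a = f x (c • a))
    (hX : ∀ x a, f (laurentD k x) a = f x ((Polynomial.X : k[X]) • a)) : Coeff k C →+ P :=
  TensorProduct.liftAddHom
    (f.comp (Module.AEval'.of (laurentD k)).symm.toLinearMap.toAddMonoidHom)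
    (balanced_of_X _ (fun c x a => by simpa using hC c _ a) (fun x a => by
      have h := hX ((Module.AEval'.of (laurentD k)).symm x) a
      simpa [Module.AEval.of_symm_X_smul] using h))

@[simp]
theorem coeffLift_coeff {P : Type*} [AddCommGroup P] (f : k[T;T⁻¹] →+ C →+ P) (hC hX)
    (x : k[T;T⁻¹]) (a : C) : coeffLift f hC hX (coeff x a) = f x a := by
  rw [coeffLift, coeff]
  exact TensorProduct.liftAddHom_tmul _ _ _ _

variable [ConformalAlgebra k C]

/-- The product `a(x) b(y) = ∑_{s ≥ 0} (a ₍ₛ₎ b)(∂ˢx/s! · y)`, a finite sum by locality. For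
`x = t ^ n` and `y = t ^ m` it is `∑_{s ≥ 0} binom(n, s) (a ₍ₛ₎ b)(n + m - s)`. -/
def coeffProd (x : k[T;T⁻¹]) (a : C) (y : k[T;T⁻¹]) (b : C) : Coeff k C :=
  ∑ᶠ s : ℕ, coeff (laurentHasse k s x * y) (nprod (k := k) s a b)

theorem finite_support {P : Type*} [AddCommGroup P] (a b : C) (f : ℕ → C → P)
    (hf : ∀ s, f s 0 = 0) :
    (Function.support fun s : ℕ => f s (nprod (k := k) s a b)).Finite := by
  obtain ⟨N, hN⟩ := locality (k := k) a b
  refine (Set.finite_lt_nat N).subset fun s hs => ?_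
  by_contra h
  exact hs (by simp only [hN s (not_lt.mp h), hf])

theorem coeffProd_finite (x : k[T;T⁻¹]) (a : C) (y : k[T;T⁻¹]) (b : C) :
    (Function.support fun s : ℕ =>
      coeff (laurentHasse k s x * y) (nprod (k := k) s a b)).Finite :=
  finite_support a b (fun s c => coeff (laurentHasse k s x * y) c) fun _ => coeff_zero_right _

theorem coeffProd_eq_sum (x : k[T;T⁻¹]) (a : C) (y : k[T;T⁻¹]) (b : C) (N : ℕ)
    (hN : ∀ n, N ≤ n → nprod (k := k) n a b = 0) :
    coeffProd x a y b
      = ∑ s ∈ Finset.range N, coeff (laurentHasse k s x * y) (nprod (k := k) s a b) := by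
  refine finsum_eq_sum_of_support_subset _ fun s hs => ?_
  by_contra h
  refine hs ?_
  simp only [Finset.coe_range, Set.mem_Iio, not_lt] at h
  simp only [hN s h, coeff_zero_right]

theorem coeffProd_add₁ (x x' : k[T;T⁻¹]) (a : C) (y : k[T;T⁻¹]) (b : C) :
    coeffProd (x + x') a y b = coeffProd x a y b + coeffProd x' a y b := by
  rw [coeffProd, coeffProd, coeffProd, ← finsum_add_distrib (coeffProd_finite _ _ _ _)
    (coeffProd_finite _ _ _ _)]
  simp only [map_add, add_mul, coeff_add_left]

theorem coeffProd_add₂ (x : k[T;T⁻¹]) (a a' : C) (y : k[T;T⁻¹]) (b : C) :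
    coeffProd x (a + a') y b = coeffProd x a y b + coeffProd x a' y b := by
  rw [coeffProd, coeffProd, coeffProd, ← finsum_add_distrib (coeffProd_finite _ _ _ _)
    (coeffProd_finite _ _ _ _)]
  simp only [map_add, LinearMap.add_apply, coeff_add_right]

theorem coeffProd_add₃ (x : k[T;T⁻¹]) (a : C) (y y' : k[T;T⁻¹]) (b : C) :
    coeffProd x a (y + y') b = coeffProd x a y b + coeffProd x a y' b := by
  rw [coeffProd, coeffProd, coeffProd, ← finsum_add_distrib (coeffProd_finite _ _ _ _)
    (coeffProd_finite _ _ _ _)]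
  simp only [mul_add, coeff_add_left]

theorem coeffProd_add₄ (x : k[T;T⁻¹]) (a : C) (y : k[T;T⁻¹]) (b b' : C) :
    coeffProd x a y (b + b') = coeffProd x a y b + coeffProd x a y b' := by
  rw [coeffProd, coeffProd, coeffProd, ← finsum_add_distrib (coeffProd_finite _ _ _ _)
    (coeffProd_finite _ _ _ _)]
  simp only [map_add, coeff_add_right]

theorem coeffProd_smul₁ (c : k) (x : k[T;T⁻¹]) (a : C) (y : k[T;T⁻¹]) (b : C) :
    coeffProd (c • x) a y b = c • coeffProd x a y b := by
  rw [coeffProd, coeffProd, smul_finsum]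
  simp only [map_smul, smul_mul_assoc, coeff_smul_left]

theorem coeffProd_smul₂ (c : k) (x : k[T;T⁻¹]) (a : C) (y : k[T;T⁻¹]) (b : C) :
    coeffProd x (c • a) y b = c • coeffProd x a y b := by
  rw [coeffProd, coeffProd, smul_finsum]
  simp only [map_smul, LinearMap.smul_apply, coeff_smul_right]

theorem coeffProd_smul₃ (c : k) (x : k[T;T⁻¹]) (a : C) (y : k[T;T⁻¹]) (b : C) :
    coeffProd x a (c • y) b = c • coeffProd x a y b := by
  rw [coeffProd, coeffProd, smul_finsum]
  simp only [mul_smul_comm, coeff_smul_left]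

theorem coeffProd_smul₄ (c : k) (x : k[T;T⁻¹]) (a : C) (y : k[T;T⁻¹]) (b : C) :
    coeffProd x a y (c • b) = c • coeffProd x a y b := by
  rw [coeffProd, coeffProd, smul_finsum]
  simp only [map_smul, coeff_smul_right]

theorem exists_bound (a b : C) : ∃ N : ℕ, ∀ n, N ≤ n →
    nprod (k := k) n a b = 0 ∧ nprod (k := k) n ((Polynomial.X : k[X]) • a) b = 0
      ∧ nprod (k := k) n a ((Polynomial.X : k[X]) • b) = 0 := by
  obtain ⟨N₁, h₁⟩ := locality (k := k) a b
  obtain ⟨N₂, h₂⟩ := locality (k := k) ((Polynomial.X : k[X]) • a) b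
  obtain ⟨N₃, h₃⟩ := locality (k := k) a ((Polynomial.X : k[X]) • b)
  exact ⟨max N₁ (max N₂ N₃), fun n hn =>
    ⟨h₁ n (by omega), h₂ n (by omega), h₃ n (by omega)⟩⟩

theorem coeffProd_D₁ (x : k[T;T⁻¹]) (a : C) (y : k[T;T⁻¹]) (b : C) :
    coeffProd (laurentD k x) a y b = coeffProd x ((Polynomial.X : k[X]) • a) y b := by
  obtain ⟨N, hN⟩ := exists_bound (k := k) a b
  rw [coeffProd_eq_sum _ _ _ _ N fun n hn => (hN n hn).1,
    coeffProd_eq_sum _ _ _ _ (N + 1) fun n hn => (hN n (by omega)).2.1, Finset.sum_range_succ']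
  simp only [D_nprod, Nat.cast_zero, zero_smul, neg_zero, coeff_zero_right, add_zero, hasse_D]
  refine Finset.sum_congr rfl fun s _ => ?_
  rw [← neg_smul, ← neg_smul, coeff_smul_right, smul_mul_assoc, coeff_smul_left]
  simp

theorem coeffProd_D₂ (x : k[T;T⁻¹]) (a : C) (y : k[T;T⁻¹]) (b : C) :
    coeffProd x a (laurentD k y) b = coeffProd x a y ((Polynomial.X : k[X]) • b) := by
  obtain ⟨N, hN⟩ := exists_bound (k := k) a b
  rw [coeffProd_eq_sum _ _ _ _ N fun n hn => (hN n hn).1,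
    coeffProd_eq_sum _ _ _ _ (N + 1) fun n hn => (hN n (by omega)).2.2]
  simp only [nprod_D, coeff_add_right, Finset.sum_add_distrib]
  rw [Finset.sum_range_succ, Finset.sum_range_succ' (fun s => coeff _ ((s : k) • _))]
  simp only [(hN N le_rfl).1, smul_zero, coeff_zero_right, add_zero, Nat.cast_zero, zero_smul]
  rw [← Finset.sum_add_distrib]
  refine Finset.sum_congr rfl fun s _ => ?_
  rw [coeff_D, D_mul, D_hasse, coeff_add_left, coeff_smul_right, ← neg_smul, smul_mul_assoc,
    coeff_smul_left]
  simp only [Nat.cast_add, Nat.cast_one, Nat.add_sub_cancel, neg_smul]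
  abel

/-- The additive map `b(y) ↦ a(x) b(y)`. -/
def coeffMulLeft (x : k[T;T⁻¹]) (a : C) : Coeff k C →+ Coeff k C :=
  coeffLift
    (AddMonoidHom.mk' (fun y => AddMonoidHom.mk' (fun b => coeffProd x a y b)
      fun b b' => coeffProd_add₄ x a y b b')
      fun y y' => by ext b; exact coeffProd_add₃ x a y y' b)
    (fun c y b => (coeffProd_smul₃ c x a y b).trans (coeffProd_smul₄ c x a y b).symm)
    (fun y b => coeffProd_D₂ x a y b)

theorem coeffMulLeft_coeff (x : k[T;T⁻¹]) (a : C) (y : k[T;T⁻¹]) (b : C) :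
    coeffMulLeft x a (coeff y b) = coeffProd x a y b :=
  coeffLift_coeff _ _ _ y b

/-- The multiplication of the coefficient algebra as a biadditive map. -/
def coeffMul : Coeff k C →+ Coeff k C →+ Coeff k C :=
  coeffLift
    (AddMonoidHom.mk' (fun x => AddMonoidHom.mk' (fun a => coeffMulLeft x a)
        fun a a' => coeff_addHom_ext fun y b => by
          rw [AddMonoidHom.add_apply, coeffMulLeft_coeff, coeffMulLeft_coeff, coeffMulLeft_coeff,
            coeffProd_add₂])
      fun x x' => by
        ext1 a
        refine coeff_addHom_ext fun y b => ?_
        change coeffMulLeft (x + x') a _ = coeffMulLeft x a _ + coeffMulLeft x' a _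
        rw [coeffMulLeft_coeff, coeffMulLeft_coeff, coeffMulLeft_coeff, coeffProd_add₁])
    (fun c x a => coeff_addHom_ext fun y b => by
      change coeffMulLeft (c • x) a _ = coeffMulLeft x (c • a) _
      rw [coeffMulLeft_coeff, coeffMulLeft_coeff, coeffProd_smul₁, coeffProd_smul₂])
    (fun x a => coeff_addHom_ext fun y b => by
      change coeffMulLeft (laurentD k x) a _ = coeffMulLeft x ((Polynomial.X : k[X]) • a) _
      rw [coeffMulLeft_coeff, coeffMulLeft_coeff, coeffProd_D₁])

theorem coeffMul_coeff (x : k[T;T⁻¹]) (a : C) : coeffMul (coeff x a) = coeffMulLeft x a :=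
  coeffLift_coeff _ _ _ x a

instance : NonUnitalNonAssocRing (Coeff k C) where
  __ := (inferInstance : AddCommGroup (Coeff k C))
  mul u v := coeffMul u v
  left_distrib u v w := map_add (coeffMul u) v w
  right_distrib u v w := by
    change coeffMul (u + v) w = coeffMul u w + coeffMul v w
    rw [map_add]; rfl
  zero_mul u := by
    change coeffMul 0 u = 0
    rw [map_zero]; rfl
  mul_zero u := map_zero (coeffMul u)

theorem coeff_mul_coeff (x y : k[T;T⁻¹]) (a b : C) :
    coeff x a * coeff y b = coeffProd x a y b := by
  change coeffMul (coeff x a) (coeff y b) = _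
  rw [coeffMul_coeff, coeffMulLeft_coeff]

/-- The defining formula `a(n) b(m) = ∑_{s ≥ 0} binom(n, s) (a ₍ₛ₎ b)(n + m - s)`. -/
theorem coeff_T_mul_coeff_T (n m : ℤ) (a b : C) :
    coeff (LaurentPolynomial.T n : k[T;T⁻¹]) a * coeff (LaurentPolynomial.T m : k[T;T⁻¹]) b
      = ∑ᶠ s : ℕ, ((Ring.choose n s : ℤ) : k) •
          coeff (LaurentPolynomial.T (n + m - s) : k[T;T⁻¹]) (nprod (k := k) s a b) := by
  rw [coeff_mul_coeff, coeffProd]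
  refine finsum_congr fun s => ?_
  rw [laurentHasse_T, smul_mul_assoc, coeff_smul_left, ← LaurentPolynomial.T_add]
  congr 3
  ring

instance : IsScalarTower k (Coeff k C) (Coeff k C) where
  smul_assoc c u v := by
    simp only [smul_eq_mul]
    induction u using coeff_induction with
    | h0 => simp
    | h2 u u' hu hu' => simp only [smul_add, add_mul, hu, hu']
    | h1 x a =>
      induction v using coeff_induction with
      | h0 => simp
      | h2 v v' hv hv' => simp only [smul_add, mul_add, hv, hv']
      | h1 y b => rw [← coeff_smul_left, coeff_mul_coeff, coeff_mul_coeff, coeffProd_smul₁]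

instance : SMulCommClass k (Coeff k C) (Coeff k C) where
  smul_comm c u v := by
    simp only [smul_eq_mul]
    induction u using coeff_induction with
    | h0 => simp
    | h2 u u' hu hu' => simp only [smul_add, add_mul, hu, hu']
    | h1 x a =>
      induction v using coeff_induction with
      | h0 => simp
      | h2 v v' hv hv' => simp only [smul_add, mul_add, hv, hv']
      | h1 y b => rw [← coeff_smul_left, coeff_mul_coeff, coeff_mul_coeff, coeffProd_smul₃]

end Coeff

/-! ### Tensor powers of `H = k[D]` and the pseudoproduct -/

section HPow

variable (k : Type*) [Field k]

/-- The tensor power `H^{⊗ n}` over `k` of `H = k[D]`. -/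
def HPow (n : ℕ) : Type _ := ⨂[k] _ : Fin n, k[X]

instance (n : ℕ) : CommRing (HPow k n) := inferInstanceAs (CommRing (⨂[k] _ : Fin n, k[X]))

instance (n : ℕ) : Algebra k (HPow k n) := inferInstanceAs (Algebra k (⨂[k] _ : Fin n, k[X]))

/-- The pure tensor `h₁ ⊗ ⋯ ⊗ hₙ`. -/
def pure {n : ℕ} (h : Fin n → k[X]) : HPow k n := PiTensorProduct.tprod k h

/-- The homomorphism `H → H^{⊗ n}`, `h ↦ 1 ⊗ ⋯ ⊗ h ⊗ ⋯ ⊗ 1`, with `h` in position `i`. -/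
def leg {n : ℕ} (i : Fin n) : k[X] →ₐ[k] HPow k n :=
  PiTensorProduct.singleAlgHom (A := fun _ : Fin n => k[X]) i

/-- The algebra homomorphism `h₁ ⊗ ⋯ ⊗ hₙ ↦ φ₁(h₁) ⋯ φₙ(hₙ)`. -/
def prodHom {n : ℕ} {S : Type*} [CommRing S] [Algebra k S] (φ : Fin n → k[X] →ₐ[k] S) :
    HPow k n →ₐ[k] S :=
  PiTensorProduct.liftAlgHom
    ((MultilinearMap.mkPiAlgebra k (Fin n) S).compLinearMap fun i => (φ i).toLinearMap)
    (by simp) (fun x y => by simp [Finset.prod_mul_distrib])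

/-- The iterated coproduct `Δ^{(n)} : H → H^{⊗ n}`: the algebra homomorphism with
`D ↦ ∑ᵢ 1 ⊗ ⋯ ⊗ D ⊗ ⋯ ⊗ 1`. -/
def comulPow (n : ℕ) : k[X] →ₐ[k] HPow k n :=
  Polynomial.aeval (∑ i : Fin n, leg k i (Polynomial.X : k[X]))

/-- The action `(f₁ ⊗ ⋯ ⊗ fₙ) h = f₁ h₍₁₎ ⊗ ⋯ ⊗ fₙ h₍ₙ₎` of the commutative algebra `H` on
`H^{⊗ n}`, that is, multiplication by `Δ^{(n)}(h)`. -/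
instance (n : ℕ) : Algebra k[X] (HPow k n) := (comulPow k n).toRingHom.toAlgebra

instance (n : ℕ) : IsScalarTower k k[X] (HPow k n) :=
  IsScalarTower.of_algebraMap_eq fun c => ((comulPow k n).commutes c).symm

variable {k}

theorem smul_HPow {n : ℕ} (h : k[X]) (F : HPow k n) : h • F = comulPow k n h * F :=
  Algebra.smul_def h F

theorem prodHom_pure {n : ℕ} {S : Type*} [CommRing S] [Algebra k S] (φ : Fin n → k[X] →ₐ[k] S)
    (h : Fin n → k[X]) : prodHom k φ (pure k h) = ∏ i, φ i (h i) :=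
  (PiTensorProduct.lift.tprod _).trans (by simp)

theorem prodHom_single {n : ℕ} {S : Type*} [CommRing S] [Algebra k S] (φ : Fin n → k[X] →ₐ[k] S)
    (i : Fin n) (h : k[X]) : prodHom k φ (leg k i h) = φ i h := by
  change prodHom k φ (pure k (Pi.mulSingle i h)) = _
  rw [prodHom_pure, Finset.prod_eq_single i]
  · simp
  · intro j _ hj
    simp [Pi.mulSingle_eq_of_ne hj]
  · simp

variable (k) in
/-- The homomorphism `H^{⊗ n} → H^{⊗ (n + m)}`, `F ↦ F ⊗ 1`. -/
def inclLeft (n m : ℕ) : HPow k n →ₐ[k] HPow k (n + m) :=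
  prodHom k fun i => leg k (Fin.castAdd m i)

variable (k) in
/-- The homomorphism `H^{⊗ m} → H^{⊗ (n + m)}`, `G ↦ 1 ⊗ G`. -/
def inclRight (n m : ℕ) : HPow k m →ₐ[k] HPow k (n + m) :=
  prodHom k fun j => leg k (Fin.natAdd n j)

/-- The element `F ⊗ G` of `H^{⊗ (n + m)}`. -/
def outer {n m : ℕ} (F : HPow k n) (G : HPow k m) : HPow k (n + m) :=
  inclLeft k n m F * inclRight k n m G

theorem pure_eq_prod {n : ℕ} (h : Fin n → k[X]) :
    pure k h = ∏ i, leg k i (h i) := by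
  have : AlgHom.id k (HPow k n)
      = prodHom k fun i => leg k i :=
    PiTensorProduct.algHom_ext fun i => AlgHom.ext fun x =>
      (prodHom_single (fun i => leg k i) i x).symm
  rw [← prodHom_pure, ← this]; rfl

/-- `outer` is concatenation of tensors. -/
theorem outer_pure {n m : ℕ} (f : Fin n → k[X]) (g : Fin m → k[X]) :
    outer (pure k f) (pure k g)
      = pure k (Fin.append f g) := by
  rw [outer, inclLeft, inclRight, prodHom_pure, prodHom_pure, pure_eq_prod (Fin.append f g),
    Fin.prod_univ_add]
  simp

variable (k) in
/-- The homomorphism `Δ^{(n)} ⊗ Δ^{(m)} : H ⊗ H → H^{⊗ (n + m)}`. -/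
def comulComul (n m : ℕ) : HPow k 2 →ₐ[k] HPow k (n + m) :=
  prodHom k ![(inclLeft k n m).comp (comulPow k n), (inclRight k n m).comp (comulPow k m)]

theorem comulComul_pure (n m : ℕ) (f g : k[X]) :
    comulComul k n m (pure k ![f, g])
      = outer (comulPow k n f) (comulPow k m g) := by
  simp [comulComul, prodHom_pure, outer, Fin.prod_univ_two]

theorem comulComul_comulPow (n m : ℕ) (h : k[X]) :
    comulComul k n m (comulPow k 2 h) = comulPow k (n + m) h := by
  have : (comulComul k n m).comp (comulPow k 2) = comulPow k (n + m) := by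
    refine Polynomial.algHom_ext ?_
    simp only [AlgHom.comp_apply, comulPow, Polynomial.aeval_X, map_sum, map_add, Fin.sum_univ_two,
      comulComul, prodHom_single, Matrix.cons_val_zero, Matrix.cons_val_one, Fin.sum_univ_add,
      inclLeft, inclRight]
  exact DFunLike.congr_fun this h

variable (k) in
/-- `Δ^{(n)} ⊗ Δ^{(m)}` as an `H`-linear map. -/
def comulComulLin (n m : ℕ) : HPow k 2 →ₗ[k[X]] HPow k (n + m) where
  toFun := comulComul k n m
  map_add' := map_add _
  map_smul' h F := by
    simp only [smul_HPow, map_mul, comulComul_comulPow, RingHom.id_apply]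

variable (k) in
/-- The action of a permutation `σ` on `H^{⊗ n}`: it carries `h₁ ⊗ ⋯ ⊗ hₙ` to the tensor whose
factor in position `σ i` is `hᵢ`. -/
def permHPow {n : ℕ} (σ : Equiv.Perm (Fin n)) : HPow k n →ₗ[k] HPow k n :=
  (PiTensorProduct.reindex k (fun _ : Fin n => k[X]) σ).toLinearMap

theorem permHPow_pure {n : ℕ} (σ : Equiv.Perm (Fin n)) (h : Fin n → k[X]) :
    permHPow k σ (pure k h) = pure k fun i => h (σ.symm i) :=
  PiTensorProduct.reindex_tprod _ _

theorem permHPow_eq {n : ℕ} (σ : Equiv.Perm (Fin n)) (F : HPow k n) :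
    permHPow k σ F = prodHom k (fun i => leg k (σ i)) F := by
  have : permHPow k σ
      = (prodHom k (fun i => leg k (σ i)) : HPow k n →ₐ[k] HPow k n).toLinearMap := by
    refine PiTensorProduct.ext (MultilinearMap.ext fun f => ?_)
    change permHPow k σ (pure k f) = prodHom k (fun i => leg k (σ i)) (pure k f)
    rw [permHPow_pure, prodHom_pure, pure_eq_prod, ← Equiv.prod_comp σ]
    simp
  exact DFunLike.congr_fun this F

/-- The action of a permutation `σ` on `H^{⊗ n}` is `H`-linear. -/
def permMap {n : ℕ} (σ : Equiv.Perm (Fin n)) : HPow k n →ₗ[k[X]] HPow k n where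
  toFun := permHPow k σ
  map_add' := map_add _
  map_smul' h F := by
    have : (prodHom k (fun i => leg k (σ i))).comp (comulPow k n)
        = comulPow k n := by
      refine Polynomial.algHom_ext ?_
      simp only [AlgHom.comp_apply, comulPow, Polynomial.aeval_X, map_sum, prodHom_single]
      exact Equiv.sum_comp σ fun i => leg k i Polynomial.X
    have h2 : prodHom k (fun i => leg k (σ i)) (comulPow k n h) = comulPow k n h :=
      DFunLike.congr_fun this h
    rw [permHPow_eq, permHPow_eq, smul_HPow, smul_HPow, map_mul, h2, RingHom.id_apply]

end HPow

section Pseudo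

variable {k C : Type*} [Field k] [CharZero k] [AddCommGroup C] [Module k C]
    [Module k[X] C] [IsScalarTower k k[X] C]

variable (k C) in
/-- The space `H^{⊗ n} ⊗_H C`. -/
abbrev PowTensor (n : ℕ) : Type _ := HPow k n ⊗[k[X]] C

variable (k) [ConformalAlgebra k C]

/-- The pseudoproduct `a * b = ∑_{s ≥ 0} ((-D)^s / s! ⊗ 1) ⊗_H (a ₍ₛ₎ b)`, a finite sum by
locality. -/
def pseudoProd (a b : C) : PowTensor k C 2 :=
  ∑ᶠ s : ℕ, (pure k
    ![((s.factorial : k)⁻¹) • (-Polynomial.X : k[X]) ^ s, 1] : HPow k 2) ⊗ₜ[k[X]]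
      nprod (k := k) s a b

theorem pseudoProd_finite (a b : C) :
    (Function.support fun s : ℕ => (pure k
      ![((s.factorial : k)⁻¹) • (-Polynomial.X : k[X]) ^ s, 1] : HPow k 2) ⊗ₜ[k[X]]
        nprod (k := k) s a b).Finite :=
  finite_support a b (fun s c => (pure k
    ![((s.factorial : k)⁻¹) • (-Polynomial.X : k[X]) ^ s, 1] : HPow k 2) ⊗ₜ[k[X]] c)
    fun _ => TensorProduct.tmul_zero _ _

theorem pseudoProd_eq_sum (a b : C) (N : ℕ) (hN : ∀ n, N ≤ n → nprod (k := k) n a b = 0) :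
    pseudoProd k a b = ∑ s ∈ Finset.range N, (pure k
      ![((s.factorial : k)⁻¹) • (-Polynomial.X : k[X]) ^ s, 1] : HPow k 2) ⊗ₜ[k[X]]
        nprod (k := k) s a b := by
  refine finsum_eq_sum_of_support_subset _ fun s hs => ?_
  by_contra h
  refine hs ?_
  simp only [Finset.coe_range, Set.mem_Iio, not_lt] at h
  simp only [hN s h, TensorProduct.tmul_zero]

theorem pseudoProd_add_left (a a' b : C) :
    pseudoProd k (a + a') b = pseudoProd k a b + pseudoProd k a' b := by
  rw [pseudoProd, pseudoProd, pseudoProd, ← finsum_add_distrib (pseudoProd_finite k _ _)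
    (pseudoProd_finite k _ _)]
  simp only [map_add, LinearMap.add_apply, TensorProduct.tmul_add]

theorem pseudoProd_add_right (a b b' : C) :
    pseudoProd k a (b + b') = pseudoProd k a b + pseudoProd k a b' := by
  rw [pseudoProd, pseudoProd, pseudoProd, ← finsum_add_distrib (pseudoProd_finite k _ _)
    (pseudoProd_finite k _ _)]
  simp only [map_add, TensorProduct.tmul_add]

theorem pure_pair (f : k[X]) : pure k ![f, 1] = (leg k 0 f : HPow k 2) := by
  rw [pure_eq_prod, Fin.prod_univ_two]
  simp

theorem comulPow_two_X : comulPow k 2 Polynomial.X = leg k 0 Polynomial.X + leg k 1 Polynomial.X := by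
  simp only [comulPow, Polynomial.aeval_X, Fin.sum_univ_two]

/-- The polynomial `(-D)^s / s!`. -/
def divPow (s : ℕ) : k[X] := ((s.factorial : k)⁻¹) • (-Polynomial.X : k[X]) ^ s

theorem divPow_succ (s : ℕ) :
    ((s : k) + 1) • divPow k (s + 1) = -(Polynomial.X * divPow k s) := by
  have h : (s : k) + 1 ≠ 0 := by exact_mod_cast s.succ_ne_zero
  rw [divPow, divPow, smul_smul, Nat.factorial_succ, pow_succ', mul_smul_comm, neg_mul, smul_neg]
  push_cast
  rw [mul_inv, mul_inv_cancel_left₀ h]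

theorem pseudoProd_X_left (a b : C) :
    pseudoProd k ((Polynomial.X : k[X]) • a) b
      = (leg k 0 Polynomial.X : HPow k 2) • pseudoProd k a b := by
  obtain ⟨N, hN⟩ := exists_bound (k := k) a b
  rw [pseudoProd_eq_sum _ _ _ N fun n hn => (hN n hn).1,
    pseudoProd_eq_sum _ _ _ (N + 1) fun n hn => (hN n (by omega)).2.1, Finset.sum_range_succ',
    Finset.smul_sum]
  simp only [D_nprod, Nat.cast_zero, zero_smul, neg_zero, TensorProduct.tmul_zero, add_zero]
  refine Finset.sum_congr rfl fun s _ => ?_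
  change pure k ![divPow k (s + 1), 1] ⊗ₜ[k[X]] _ = _ •
    pure k ![divPow k s, 1] ⊗ₜ[k[X]] _
  rw [pure_pair, pure_pair, TensorProduct.smul_tmul', smul_eq_mul, ← map_mul, ← neg_neg
    (Polynomial.X * divPow k s), ← divPow_succ, TensorProduct.tmul_neg, ← algebraMap_smul k[X],
    ← TensorProduct.smul_tmul, algebraMap_smul, map_neg, map_smul, TensorProduct.neg_tmul]
  simp

theorem pseudoProd_X_right (a b : C) :
    pseudoProd k a ((Polynomial.X : k[X]) • b)
      = (leg k 1 Polynomial.X : HPow k 2) • pseudoProd k a b := by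
  obtain ⟨N, hN⟩ := exists_bound (k := k) a b
  rw [pseudoProd_eq_sum _ _ _ N fun n hn => (hN n hn).1,
    pseudoProd_eq_sum _ _ _ (N + 1) fun n hn => (hN n (by omega)).2.2, Finset.smul_sum]
  change ∑ s ∈ Finset.range (N + 1), pure k ![divPow k s, 1] ⊗ₜ[k[X]] _
    = ∑ s ∈ Finset.range N, _ • pure k ![divPow k s, 1] ⊗ₜ[k[X]] _
  simp only [nprod_D, TensorProduct.tmul_add, Finset.sum_add_distrib, pure_pair]
  rw [Finset.sum_range_succ, Finset.sum_range_succ' (fun s => _ ⊗ₜ[k[X]] ((s : k) • _))]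
  simp only [(hN N le_rfl).1, smul_zero, TensorProduct.tmul_zero, add_zero, Nat.cast_zero,
    zero_smul]
  rw [← Finset.sum_add_distrib]
  refine Finset.sum_congr rfl fun s _ => ?_
  have h : ((s + 1 : ℕ) : k) • (leg k 0 (divPow k (s + 1)) : HPow k 2)
      = -(leg k 0 Polynomial.X * leg k 0 (divPow k s)) := by
    rw [← map_smul (leg k 0 : k[X] →ₐ[k] HPow k 2) ((s + 1 : ℕ) : k), Nat.cast_succ, divPow_succ,
      map_neg, map_mul]
  rw [← TensorProduct.smul_tmul, ← algebraMap_smul k[X] ((s + 1 : ℕ) : k),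
    ← TensorProduct.smul_tmul, algebraMap_smul, h, TensorProduct.smul_tmul', smul_eq_mul,
    Nat.add_sub_cancel, ← TensorProduct.add_tmul, smul_HPow, comulPow_two_X]
  congr 1
  ring

theorem smul_ind {n : ℕ} (i : Fin n) (f : C → PowTensor k C n)
    (hadd : ∀ a b, f (a + b) = f a + f b) (hC : ∀ (c : k) a, f (c • a) = c • f a)
    (hX : ∀ a, f ((Polynomial.X : k[X]) • a) = (leg k i Polynomial.X : HPow k n) • f a)
    (h : k[X]) (a : C) : f (h • a) = (leg k i h : HPow k n) • f a := by
  induction h using Polynomial.induction_on generalizing a with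
  | C c =>
    rw [← Polynomial.algebraMap_eq, algebraMap_smul, AlgHom.commutes, algebraMap_smul, hC]
  | add p q hp hq => rw [add_smul, hadd, hp, hq, map_add, add_smul]
  | monomial j c ih => rw [pow_succ, ← mul_assoc, mul_smul, ih, hX, smul_smul, ← map_mul]

theorem pseudoProd_C_left (c : k) (a b : C) : pseudoProd k (c • a) b = c • pseudoProd k a b := by
  rw [pseudoProd, pseudoProd, smul_finsum]
  refine finsum_congr fun s => ?_
  rw [map_smul, LinearMap.smul_apply, TensorProduct.tmul_smul]

theorem pseudoProd_C_right (c : k) (a b : C) : pseudoProd k a (c • b) = c • pseudoProd k a b := by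
  rw [pseudoProd, pseudoProd, smul_finsum]
  refine finsum_congr fun s => ?_
  rw [map_smul, TensorProduct.tmul_smul]

/-- `H`-bilinearity of the pseudoproduct, first argument. -/
theorem pseudoProd_smul_left (h : k[X]) (a b : C) :
    pseudoProd k (h • a) b = (leg k 0 h : HPow k 2) • pseudoProd k a b :=
  smul_ind k 0 (fun a => pseudoProd k a b) (fun a a' => pseudoProd_add_left k a a' b)
    (fun c a => pseudoProd_C_left k c a b) (fun a => pseudoProd_X_left k a b) h a

/-- `H`-bilinearity of the pseudoproduct, second argument. -/
theorem pseudoProd_smul_right (h : k[X]) (a b : C) :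
    pseudoProd k a (h • b) = (leg k 1 h : HPow k 2) • pseudoProd k a b :=
  smul_ind k 1 (fun b => pseudoProd k a b) (fun b b' => pseudoProd_add_right k a b b')
    (fun c b => pseudoProd_C_right k c a b) (fun b => pseudoProd_X_right k a b) h b

/-- The map `(Δ^{(n)} ⊗ Δ^{(m)}) ⊗_H id`. -/
def comulComulTensor (n m : ℕ) : PowTensor k C 2 →ₗ[k[X]] PowTensor k C (n + m) :=
  (comulComulLin k n m).rTensor C

theorem comulComulTensor_smul (n m : ℕ) (F : HPow k 2) (u : PowTensor k C 2) :
    comulComulTensor k n m (F • u) = comulComul k n m F • comulComulTensor k n m u := by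
  induction u using TensorProduct.induction_on with
  | zero => simp
  | add u v hu hv => simp only [smul_add, map_add, hu, hv]
  | tmul G c =>
    rw [TensorProduct.smul_tmul', comulComulTensor, LinearMap.rTensor_tmul,
      LinearMap.rTensor_tmul, TensorProduct.smul_tmul', smul_eq_mul, smul_eq_mul]
    congr 1
    exact map_mul (comulComul k n m) F G

/-- The value `(F ⊗_H a) * (G ⊗_H b) = (F ⊗ G ⊗_H 1) (Δ^{(n)} ⊗ Δ^{(m)} ⊗_H id) (a * b)` of the
expanded pseudoproduct. -/
def expandedAux {n m : ℕ} (F : HPow k n) (a : C) (G : HPow k m) (b : C) : PowTensor k C (n + m) :=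
  outer F G • comulComulTensor k n m (pseudoProd k a b)

variable {k} in
theorem expandedAux_balanced_left {n m : ℕ} (h : k[X]) (F : HPow k n) (a : C) (G : HPow k m)
    (b : C) : expandedAux k (h • F) a G b = expandedAux k F (h • a) G b := by
  rw [expandedAux, expandedAux, pseudoProd_smul_left, comulComulTensor_smul, smul_smul]
  congr 1
  rw [comulComul, prodHom_single, outer, outer, smul_HPow, map_mul, Matrix.cons_val_zero,
    AlgHom.comp_apply]
  ring

variable {k} in
theorem expandedAux_balanced_right {n m : ℕ} (h : k[X]) (F : HPow k n) (a : C) (G : HPow k m)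
    (b : C) : expandedAux k F a (h • G) b = expandedAux k F a G (h • b) := by
  rw [expandedAux, expandedAux, pseudoProd_smul_right, comulComulTensor_smul, smul_smul]
  congr 1
  rw [comulComul, prodHom_single, outer, outer, smul_HPow, map_mul, Matrix.cons_val_one,
    Matrix.cons_val_fin_one, AlgHom.comp_apply]
  ring

/-- The additive map `G ⊗_H b ↦ (F ⊗_H a) * (G ⊗_H b)`. -/
def expandedLeft {n : ℕ} (m : ℕ) (F : HPow k n) (a : C) :
    PowTensor k C m →+ PowTensor k C (n + m) :=
  TensorProduct.liftAddHom
    (AddMonoidHom.mk' (fun G => AddMonoidHom.mk' (fun b => expandedAux k F a G b)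
      fun b b' => by simp only [expandedAux, pseudoProd_add_right, map_add, smul_add])
      fun G G' => by
        ext b
        simp only [expandedAux, outer, map_add, mul_add, add_smul, AddMonoidHom.mk'_apply,
          AddMonoidHom.add_apply])
    fun h G b => expandedAux_balanced_right h F a G b

theorem expandedLeft_tmul {n m : ℕ} (F : HPow k n) (a : C) (G : HPow k m) (b : C) :
    expandedLeft k m F a (G ⊗ₜ[k[X]] b) = expandedAux k F a G b :=
  TensorProduct.liftAddHom_tmul _ _ _ _

variable {k} in
theorem powTensor_addHom_ext {n : ℕ} {P : Type*} [AddCommGroup P] {f g : PowTensor k C n →+ P}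
    (h : ∀ F a, f (F ⊗ₜ[k[X]] a) = g (F ⊗ₜ[k[X]] a)) : f = g := by
  ext u
  induction u using TensorProduct.induction_on with
  | zero => rw [map_zero, map_zero]
  | tmul F a => exact h F a
  | add u v hu hv => rw [map_add, map_add, hu, hv]

/-- The expanded pseudoproduct
`* : (H^{⊗ n} ⊗_H C) ⊗ (H^{⊗ m} ⊗_H C) → H^{⊗ (n + m)} ⊗_H C` as a biadditive map. -/
def expandedProd (n m : ℕ) :
    PowTensor k C n →+ PowTensor k C m →+ PowTensor k C (n + m) :=
  TensorProduct.liftAddHom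
    (AddMonoidHom.mk' (fun F => AddMonoidHom.mk' (fun a => expandedLeft k m F a)
      fun a a' => powTensor_addHom_ext fun G b => by
        rw [AddMonoidHom.add_apply, expandedLeft_tmul, expandedLeft_tmul, expandedLeft_tmul]
        simp only [expandedAux, pseudoProd_add_left, map_add, smul_add])
      fun F F' => by
        ext1 a
        refine powTensor_addHom_ext fun G b => ?_
        change expandedLeft k m (F + F') a _ = expandedLeft k m F a _ + expandedLeft k m F' a _
        rw [expandedLeft_tmul, expandedLeft_tmul, expandedLeft_tmul]
        simp only [expandedAux, outer, map_add, add_mul, add_smul])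
    fun h F a => powTensor_addHom_ext fun G b => by
      change expandedLeft k m (h • F) a _ = expandedLeft k m F (h • a) _
      rw [expandedLeft_tmul, expandedLeft_tmul, expandedAux_balanced_left]

theorem expandedProd_tmul {n m : ℕ} (F : HPow k n) (a : C) (G : HPow k m) (b : C) :
    expandedProd k n m (F ⊗ₜ[k[X]] a) (G ⊗ₜ[k[X]] b)
      = outer F G • comulComulTensor k n m (pseudoProd k a b) :=
  (DFunLike.congr_fun (TensorProduct.liftAddHom_tmul _ _ F a) _).trans
    (expandedLeft_tmul k F a G b)

end Pseudo

/-! ### Multilinear polynomials and identities -/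

/-- The bracketings of a word `b₁ ⋯ bₙ` of length `n`, that is, the full binary trees with
`n` leaves. -/
inductive Bracketing : ℕ → Type
  | leaf : Bracketing 1
  | node {p q : ℕ} (l : Bracketing p) (r : Bracketing q) : Bracketing (p + q)

/-- The value of the bracketed word `b₁ ⋯ bₙ` for a binary operation. -/
def Bracketing.eval {A : Type*} [Mul A] : {n : ℕ} → Bracketing n → (Fin n → A) → A
  | _, .leaf, b => b 0
  | _, .node (p := p) (q := q) l r, b =>
      l.eval (fun i => b (Fin.castAdd q i)) * r.eval (fun j => b (Fin.natAdd p j))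

/-- The value in `H^{⊗ n} ⊗_H C` of the bracketed word `b₁ ⋯ bₙ` in elements of `C`, where the
multiplication is replaced with the expanded pseudoproduct (and `b` in `C` is `1 ⊗_H b`). -/
def Bracketing.evalStar (k : Type*) {C : Type*} [Field k] [CharZero k] [AddCommGroup C]
    [Module k C] [Module k[X] C] [IsScalarTower k k[X] C] [ConformalAlgebra k C] :
    {n : ℕ} → Bracketing n → (Fin n → C) → PowTensor k C n
  | _, .leaf, b => (1 : HPow k 1) ⊗ₜ[k[X]] b 0
  | _, .node (p := p) (q := q) l r, b =>
      expandedProd k p q (l.evalStar k fun i => b (Fin.castAdd q i))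
        (r.evalStar k fun j => b (Fin.natAdd p j))

/-- A homogeneous multilinear non-associative polynomial in `n` variables, written as
`f(a₁, …, aₙ) = ∑_σ t_σ(a_{1σ}, …, a_{nσ})` with `t_σ` a linear combination of bracketings. -/
abbrev MultilinearPoly (k : Type*) [Field k] (n : ℕ) : Type _ :=
  Equiv.Perm (Fin n) → Bracketing n →₀ k

namespace MultilinearPoly

variable {k : Type*} [Field k] {n : ℕ}

/-- The element `∑_σ t_σ(x_{1σ}, …, x_{nσ})` of the free non-associative algebra on
`x₁, …, xₙ`. -/
def toFree (t : MultilinearPoly k n) : FreeNonUnitalNonAssocAlgebra k (Fin n) :=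
  ∑ σ : Equiv.Perm (Fin n), (t σ).sum fun m c =>
    c • m.eval fun i => FreeNonUnitalNonAssocAlgebra.of k (σ i)

/-- The `k`-algebra `A` satisfies the identity `f = 0`. -/
def IsIdentity (t : MultilinearPoly k n) (A : Type*) [NonUnitalNonAssocRing A] [Module k A]
    [IsScalarTower k A A] [SMulCommClass k A A] : Prop :=
  ∀ u : Fin n → A, FreeNonUnitalNonAssocAlgebra.lift k u t.toFree = 0

/-- The expression
`f^*(a₁, …, aₙ) = ∑_σ (σ ⊗_H id) t_σ^*(a_{1σ}, …, a_{nσ})` in `H^{⊗ n} ⊗_H C`. -/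
def star {C : Type*} [CharZero k] [AddCommGroup C] [Module k C] [Module k[X] C]
    [IsScalarTower k k[X] C] [ConformalAlgebra k C] (t : MultilinearPoly k n) (a : Fin n → C) :
    PowTensor k C n :=
  ∑ σ : Equiv.Perm (Fin n), (permMap σ).rTensor C
    ((t σ).sum fun m c => c • m.evalStar k fun i => a (σ i))

/-- The conformal algebra `C` as a pseudoalgebra satisfies the pseudo-identity `f^* = 0`. -/
def IsPseudoIdentity (t : MultilinearPoly k n) (C : Type*) [CharZero k] [AddCommGroup C]
    [Module k C] [Module k[X] C] [IsScalarTower k k[X] C] [ConformalAlgebra k C] : Prop :=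
  ∀ a : Fin n → C, t.star a = 0

end MultilinearPoly

end ConformalAlgebra

end

/-! Let `D` act on Laurent polynomials as `∂ = -d/dt`. Laurent polynomials `x₁, …, xₙ` define a map
`H^{⊗ n} → k[t, t⁻¹]`, `h₁ ⊗ ⋯ ⊗ hₙ ↦ ∏ hᵢ(∂) xᵢ`. As `∂` is a derivation, multiplication by
`Δ^{(n)}(D)` becomes `∂`, so this map is `H`-linear and induces `coeffPairing x : H^{⊗ n} ⊗_H C →
Coeff C`.

The pairing turns pseudo-expressions into genuine ones. It sends `1 ⊗_H a` to `a(x)` when `n = 1`.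
The operator `(-D)^s / s!` acts as the divided derivative `t ^ n ↦ binom(n, s) t ^ (n - s)`
(`aeval_divPow`), which is exactly the coefficient in the product of `Coeff C`; hence the expanded
pseudoproduct becomes that product (`coeffPairing_expandedProd`). Permuting tensor factors only
relabels the `xᵢ` (`coeffPairing_permMap`).

Consequently `f(a₁(x₁), …, aₙ(xₙ))` is the pairing of `f^*(a₁, …, aₙ)` with `x`
(`lift_toFree_coeff`), and it vanishes when `f^*` does. The elements `a(x)` span `Coeff C`
additively and `f` is additive in each variable, so `f` vanishes everywhere
(`eq_zero_of_update_add`). -/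

namespace ConformalAlgebra

/-! ### Evaluating tensor powers of `H` on Laurent polynomials -/

section Pairing

variable {k C : Type*} [Field k]

theorem leg_mul_pure {n : ℕ} (i : Fin n) (p : k[X]) (h : Fin n → k[X]) :
    leg k i p * pure k h = pure k (Function.update h i (p * h i)) := by
  rw [pure_eq_prod, pure_eq_prod, ← Finset.mul_prod_erase _ _ (Finset.mem_univ i),
    ← Finset.mul_prod_erase Finset.univ (fun j => leg k j (Function.update h i (p * h i) j))
      (Finset.mem_univ i), Function.update_self, map_mul, mul_assoc]
  congr 2
  refine Finset.prod_congr rfl fun j hj => ?_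
  rw [Function.update_of_ne (Finset.ne_of_mem_erase hj)]

theorem HPow_hom_ext {n : ℕ} {M : Type*} [AddCommGroup M] [Module k M] {f g : HPow k n →ₗ[k] M}
    (h : ∀ p, f (pure k p) = g (pure k p)) : f = g :=
  PiTensorProduct.ext (MultilinearMap.ext h)

variable [CharZero k]

/-- The map `h₁ ⊗ ⋯ ⊗ hₙ ↦ (x₁ h₁) ⋯ (xₙ hₙ)` for the action of `H` on Laurent polynomials. -/
noncomputable def laurentEval {n : ℕ} (x : Fin n → k[T;T⁻¹]) : HPow k n →ₗ[k] k[T;T⁻¹] :=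
  PiTensorProduct.lift ((MultilinearMap.mkPiAlgebra k (Fin n) k[T;T⁻¹]).compLinearMap fun i =>
    (LinearMap.applyₗ (x i)).comp (Polynomial.aeval (laurentD k)).toLinearMap)

theorem laurentEval_pure {n : ℕ} (x : Fin n → k[T;T⁻¹]) (h : Fin n → k[X]) :
    laurentEval x (pure k h) = ∏ i, Polynomial.aeval (laurentD k) (h i) (x i) :=
  (PiTensorProduct.lift.tprod _).trans (by simp)

/-- The Leibniz rule for `1 * 1` gives `∂1 = ∂1 + ∂1`. -/
theorem laurentD_one : laurentD k 1 = 0 := by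
  simpa using D_mul (1 : k[T;T⁻¹]) 1

/-- The `erase` form isolates the differentiated factor, to match the summands of `Δ^{(n)}(D)`
position by position. -/
theorem laurentD_prod {ι : Type*} [DecidableEq ι] (s : Finset ι) (y : ι → k[T;T⁻¹]) :
    laurentD k (∏ i ∈ s, y i) = ∑ i ∈ s, laurentD k (y i) * ∏ j ∈ s.erase i, y j := by
  induction s using Finset.induction_on with
  | empty => simp [laurentD_one]
  | insert a s ha ih =>
    rw [Finset.prod_insert ha, D_mul, ih, Finset.sum_insert ha, Finset.erase_insert ha,
      Finset.mul_sum]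
    congr 1
    refine Finset.sum_congr rfl fun i hi => ?_
    have hne : a ≠ i := fun h => ha (h ▸ hi)
    rw [Finset.erase_insert_of_ne hne,
      Finset.prod_insert fun h => ha (Finset.mem_of_mem_erase h)]
    ring

/-- This is the Leibniz rule: `Δ^{(n)}(D)` is the sum over positions of `D` in one factor, and so is
the derivative of a product. -/
theorem laurentEval_comulPow_X {n : ℕ} (x : Fin n → k[T;T⁻¹]) (F : HPow k n) :
    laurentEval x (comulPow k n Polynomial.X * F) = laurentD k (laurentEval x F) := by
  have : (laurentEval x).comp (LinearMap.mulLeft k (comulPow k n Polynomial.X))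
      = (laurentD k).comp (laurentEval x) := by
    refine HPow_hom_ext fun p => ?_
    simp only [LinearMap.comp_apply, LinearMap.mulLeft_apply, comulPow, Polynomial.aeval_X,
      Finset.sum_mul, leg_mul_pure, map_sum, laurentEval_pure, laurentD_prod]
    refine Finset.sum_congr rfl fun i _ => ?_
    rw [← Finset.mul_prod_erase _ _ (Finset.mem_univ i), Function.update_self, map_mul,
      Polynomial.aeval_X, Module.End.mul_apply]
    congr 1
    refine Finset.prod_congr rfl fun j hj => ?_
    rw [Function.update_of_ne (Finset.ne_of_mem_erase hj)]
  exact LinearMap.congr_fun this F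

/-- This `H`-linearity is what lets the evaluation descend to the tensor product over `H`. -/
theorem laurentEval_comulPow {n : ℕ} (x : Fin n → k[T;T⁻¹]) (h : k[X]) (F : HPow k n) :
    laurentEval x (comulPow k n h * F) = Polynomial.aeval (laurentD k) h (laurentEval x F) := by
  induction h using Polynomial.induction_on generalizing F with
  | C c =>
    rw [← Polynomial.algebraMap_eq, AlgHom.commutes, AlgHom.commutes, ← Algebra.smul_def,
      map_smul, Module.algebraMap_end_apply]
  | add p q hp hq => simp only [map_add, add_mul, LinearMap.add_apply, hp, hq]
  | monomial j c ih =>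
    rw [pow_succ, ← mul_assoc, map_mul (comulPow k n), mul_assoc, ih, laurentEval_comulPow_X,
      map_mul (Polynomial.aeval _) _ Polynomial.X, Polynomial.aeval_X, Module.End.mul_apply]

/-- Both sides are bilinear, and on pure tensors a product indexed by `Fin (n + m)` splits at `n`.
-/
theorem laurentEval_outer {n m : ℕ} (x : Fin n → k[T;T⁻¹]) (y : Fin m → k[T;T⁻¹])
    (F : HPow k n) (G : HPow k m) :
    laurentEval (Fin.append x y) (outer F G) = laurentEval x F * laurentEval y G := by
  have : ((LinearMap.mul k (HPow k (n + m))).compl₁₂ (inclLeft k n m).toLinearMap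
        (inclRight k n m).toLinearMap).compr₂ (laurentEval (Fin.append x y))
      = (LinearMap.mul k k[T;T⁻¹]).compl₁₂ (laurentEval x) (laurentEval y) := by
    refine HPow_hom_ext fun p => HPow_hom_ext fun q => ?_
    change laurentEval (Fin.append x y) (outer (pure k p) (pure k q))
      = laurentEval x (pure k p) * laurentEval y (pure k q)
    simp only [outer_pure, laurentEval_pure, Fin.prod_univ_add, Fin.append_left, Fin.append_right]
  exact LinearMap.congr_fun (LinearMap.congr_fun this F) G

theorem laurentEval_permHPow {n : ℕ} (x : Fin n → k[T;T⁻¹]) (σ : Equiv.Perm (Fin n))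
    (F : HPow k n) :
    laurentEval x (permHPow k σ F) = laurentEval (fun i => x (σ i)) F := by
  have : (laurentEval x).comp (permHPow k σ) = laurentEval fun i => x (σ i) := by
    refine HPow_hom_ext fun p => ?_
    rw [LinearMap.comp_apply, permHPow_pure, laurentEval_pure, laurentEval_pure,
      ← Equiv.prod_comp σ]
    simp
  exact LinearMap.congr_fun this F

/-- Since `D` acts as `-d/dt`, the sign in `(-D)^s` cancels and the divided power becomes `(d/dt)^s
/ s!`. This links the pseudoproduct to the binomial coefficients in `Coeff C`. -/
theorem aeval_divPow (s : ℕ) (x : k[T;T⁻¹]) :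
    Polynomial.aeval (laurentD k) (divPow k s) x = laurentHasse k s x := by
  induction s with
  | zero => simp [divPow, hasse_zero]
  | succ s ih =>
    have h : (s : k) + 1 ≠ 0 := by exact_mod_cast s.succ_ne_zero
    -- Both sides satisfy the same recursion after multiplication by `s + 1`, which characteristic
    -- zero allows to be cancelled.
    refine smul_right_injective _ h ?_
    change ((s : k) + 1) • _ = ((s : k) + 1) • _
    rw [← LinearMap.smul_apply, ← map_smul, divPow_succ, map_neg, map_mul, Polynomial.aeval_X,
      LinearMap.neg_apply, Module.End.mul_apply, ih, D_hasse, neg_neg]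

/-! ### The pairing with values in the coefficient algebra -/

variable [AddCommGroup C] [Module k C] [Module k[X] C] [IsScalarTower k k[X] C]

theorem coeff_smul_poly (h : k[X]) (x : k[T;T⁻¹]) (c : C) :
    coeff x (h • c) = coeff (Polynomial.aeval (laurentD k) h x) c := by
  induction h using Polynomial.induction_on generalizing x c with
  | C a =>
    rw [← Polynomial.algebraMap_eq, AlgHom.commutes, Module.algebraMap_end_apply, algebraMap_smul,
      coeff_smul_left, coeff_smul_right]
  | add p q hp hq =>
    rw [add_smul, coeff_add_right, hp, hq, map_add, LinearMap.add_apply, coeff_add_left]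
  | monomial j a ih =>
    -- The factor `X` split off is outermost on `c` but lands innermost on `x`; the two agree
    -- because `k[X]` is commutative.
    rw [pow_succ', mul_left_comm, mul_smul, coeff_D, ih, mul_comm Polynomial.X,
      map_mul (Polynomial.aeval _) _ Polynomial.X, Polynomial.aeval_X, Module.End.mul_apply]

/-- The map `H^{⊗ n} ⊗_H C → Coeff C`,
`(h₁ ⊗ ⋯ ⊗ hₙ) ⊗_H c ↦ ((x₁ h₁) ⋯ (xₙ hₙ)) ⊗_H c`. -/
noncomputable def coeffPairing {n : ℕ} (x : Fin n → k[T;T⁻¹]) : PowTensor k C n →+ Coeff k C :=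
  TensorProduct.liftAddHom
    (AddMonoidHom.mk' (fun F => AddMonoidHom.mk' (fun c => coeff (laurentEval x F) c)
      fun c c' => coeff_add_right _ c c')
      fun F F' => by
        ext c
        simp only [map_add, coeff_add_left, AddMonoidHom.mk'_apply, AddMonoidHom.add_apply])
    -- Balancedness over `H`: on either side `h` ends up as `h(∂)` applied to the evaluated Laurent
    -- polynomial.
    fun h F c => by
      simp only [AddMonoidHom.mk'_apply, smul_HPow, laurentEval_comulPow, coeff_smul_poly]

theorem coeffPairing_tmul {n : ℕ} (x : Fin n → k[T;T⁻¹]) (F : HPow k n) (c : C) :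
    coeffPairing x (F ⊗ₜ[k[X]] c) = coeff (laurentEval x F) c :=
  TensorProduct.liftAddHom_tmul _ _ _ _

/-- The pairing is built only as an additive map; the coefficients of `f` require `k`-linearity. -/
theorem coeffPairing_smul {n : ℕ} (x : Fin n → k[T;T⁻¹]) (r : k) (u : PowTensor k C n) :
    coeffPairing x (r • u) = r • coeffPairing x u := by
  induction u using TensorProduct.induction_on with
  | zero => simp
  | add u v hu hv => simp only [smul_add, map_add, hu, hv]
  | tmul F c =>
    rw [TensorProduct.smul_tmul', coeffPairing_tmul, coeffPairing_tmul, map_smul, coeff_smul_left]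

/-- The permutation puts factor `i` in position `σ i`, where it meets `x (σ i)`. This is the same
relabelling as that of the arguments in `star`. -/
theorem coeffPairing_permMap {n : ℕ} (x : Fin n → k[T;T⁻¹]) (σ : Equiv.Perm (Fin n))
    (u : PowTensor k C n) :
    coeffPairing x ((permMap σ).rTensor C u) = coeffPairing (fun i => x (σ i)) u := by
  induction u using TensorProduct.induction_on with
  | zero => simp
  | add u v hu hv => simp only [map_add, hu, hv]
  | tmul F c =>
    rw [LinearMap.rTensor_tmul, coeffPairing_tmul, coeffPairing_tmul, ← laurentEval_permHPow]
    rfl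

variable [ConformalAlgebra k C]

/-- The pairing turns the expanded pseudoproduct into the product of the coefficient algebra. -/
theorem coeffPairing_expandedProd {n m : ℕ} (x : Fin n → k[T;T⁻¹]) (y : Fin m → k[T;T⁻¹])
    (u : PowTensor k C n) (v : PowTensor k C m) :
    coeffPairing (Fin.append x y) (expandedProd k n m u v)
      = coeffPairing x u * coeffPairing y v := by
  induction u using TensorProduct.induction_on with
  | zero => simp
  | add u u' hu hu' => simp only [map_add, AddMonoidHom.add_apply, add_mul, hu, hu']
  | tmul F a =>
    induction v using TensorProduct.induction_on with
    | zero => simp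
    | add v v' hv hv' => simp only [map_add, mul_add, hv, hv']
    | tmul G b =>
      -- One locality bound truncates both the pseudoproduct and the product in `Coeff C`, which are
      -- then compared term by term.
      obtain ⟨N, hN⟩ := locality (k := k) a b
      rw [expandedProd_tmul, coeffPairing_tmul, coeffPairing_tmul, coeff_mul_coeff,
        coeffProd_eq_sum _ _ _ _ N hN, pseudoProd_eq_sum k _ _ N hN, map_sum, Finset.smul_sum,
        map_sum]
      refine Finset.sum_congr rfl fun s _ => ?_
      change coeffPairing _ (outer F G •
        comulComulTensor k n m (pure k ![divPow k s, 1] ⊗ₜ[k[X]] _)) = _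
      rw [comulComulTensor, LinearMap.rTensor_tmul, TensorProduct.smul_tmul', smul_eq_mul,
        coeffPairing_tmul]
      change coeff (laurentEval _ (outer F G * comulComul k n m (pure k ![divPow k s, 1]))) _ = _
      -- The second tensor factor in the pseudoproduct is `1`, so the coproduct multiplies `F` alone
      -- and only the left Laurent polynomial is differentiated.
      have h : outer F G * comulComul k n m (pure k ![divPow k s, 1])
          = outer (comulPow k n (divPow k s) * F) G := by
        rw [comulComul_pure, map_one, outer, outer, outer, map_one, map_mul]
        ring
      rw [h, laurentEval_outer, laurentEval_comulPow, aeval_divPow]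

end Pairing

/-! ### Bracketed words -/

section Eval

variable {k C : Type*} [Field k] [CharZero k] [AddCommGroup C] [Module k C]
    [Module k[X] C] [IsScalarTower k k[X] C] [ConformalAlgebra k C]

/-- By induction on the tree: a leaf contributes `1 ⊗_H b`, paired to `b(x)`, and a node is handled
by `coeffPairing_expandedProd`. -/
theorem Bracketing.eval_coeff {n : ℕ} (m : Bracketing n) (x : Fin n → k[T;T⁻¹]) (b : Fin n → C) :
    m.eval (fun i => coeff (x i) (b i)) = coeffPairing x (m.evalStar k b) := by
  induction m with
  | leaf =>
    have h : (1 : HPow k 1) = pure k fun _ => 1 := rfl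
    rw [Bracketing.eval, Bracketing.evalStar, coeffPairing_tmul, h, laurentEval_pure]
    simp
  | node l r hl hr =>
    rw [Bracketing.eval, Bracketing.evalStar, hl, hr, ← coeffPairing_expandedProd]
    congr 1
    -- A family on `Fin (p + q)` is the concatenation of its restrictions to the two halves.
    exact congrArg coeffPairing (Fin.append_castAdd_natAdd)

theorem Bracketing.map_eval {A B F : Type*} [Mul A] [Mul B] [FunLike F A B] [MulHomClass F A B]
    (φ : F) {n : ℕ} (m : Bracketing n) (b : Fin n → A) :
    φ (m.eval b) = m.eval fun i => φ (b i) := by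
  induction m with
  | leaf => rfl
  | node l r hl hr => rw [Bracketing.eval, Bracketing.eval, map_mul, hl, hr]

/-- Each variable labels exactly one leaf, so distributivity at the nodes on the way to it suffices.
-/
theorem Bracketing.eval_update_add {A : Type*} [NonUnitalNonAssocSemiring A] {n : ℕ}
    (m : Bracketing n) (b : Fin n → A) (i : Fin n) (x y : A) :
    m.eval (Function.update b i (x + y))
      = m.eval (Function.update b i x) + m.eval (Function.update b i y) := by
  induction m with
  | leaf =>
    rw [Subsingleton.elim i 0]
    simp [Bracketing.eval]
  | @node p q l r hl hr =>
    -- Changing a letter in one half of the word changes that half (`hL`, `hR`) and leaves the other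
    -- alone (`hL'`, `hR'`).
    have hL (j : Fin p) (z : A) : (fun i => Function.update b (Fin.castAdd q j) z (Fin.castAdd q i))
        = Function.update (fun i => b (Fin.castAdd q i)) j z :=
      Function.update_comp_eq_of_injective b (Fin.castAdd_injective p q) j z
    have hL' (j : Fin q) (z : A) : (fun i => Function.update b (Fin.natAdd p j) z (Fin.castAdd q i))
        = fun i => b (Fin.castAdd q i) := by
      funext i
      exact Function.update_of_ne (by simp [Fin.ext_iff]; omega) _ _
    have hR (j : Fin q) (z : A) : (fun i => Function.update b (Fin.natAdd p j) z (Fin.natAdd p i))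
        = Function.update (fun i => b (Fin.natAdd p i)) j z :=
      Function.update_comp_eq_of_injective b (Fin.natAdd_injective q p) j z
    have hR' (j : Fin p) (z : A) : (fun i => Function.update b (Fin.castAdd q j) z (Fin.natAdd p i))
        = fun i => b (Fin.natAdd p i) := by
      funext i
      exact Function.update_of_ne (by simp [Fin.ext_iff]; omega) _ _
    refine Fin.addCases (fun j => ?_) (fun j => ?_) i
    · simp only [Bracketing.eval, hL, hR', hl, add_mul]
    · simp only [Bracketing.eval, hL', hR, hr, mul_add]

/-! ### Values of multilinear polynomials -/

namespace MultilinearPoly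

variable {n : ℕ}

theorem lift_toFree {A : Type*} [NonUnitalNonAssocRing A] [Module k A] [IsScalarTower k A A]
    [SMulCommClass k A A] (f : MultilinearPoly k n) (u : Fin n → A) :
    FreeNonUnitalNonAssocAlgebra.lift k u f.toFree
      = ∑ σ : Equiv.Perm (Fin n), (f σ).sum fun m c => c • m.eval fun i => u (σ i) := by
  simp only [toFree, Finsupp.sum, map_sum, map_smul, Bracketing.map_eval,
    FreeNonUnitalNonAssocAlgebra.lift_of_apply]

theorem lift_toFree_update_add {A : Type*} [NonUnitalNonAssocRing A] [Module k A]
    [IsScalarTower k A A] [SMulCommClass k A A] (f : MultilinearPoly k n) (u : Fin n → A)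
    (i : Fin n) (x y : A) :
    FreeNonUnitalNonAssocAlgebra.lift k (Function.update u i (x + y)) f.toFree
      = FreeNonUnitalNonAssocAlgebra.lift k (Function.update u i x) f.toFree
        + FreeNonUnitalNonAssocAlgebra.lift k (Function.update u i y) f.toFree := by
  -- Variable `i` stands at place `σ⁻¹ i` of the word permuted by `σ`.
  have h (σ : Equiv.Perm (Fin n)) (z : A) : (fun j => Function.update u i z (σ j))
      = Function.update (fun j => u (σ j)) (σ.symm i) z :=
    Function.update_comp_equiv u σ i z
  simp only [lift_toFree, h, Bracketing.eval_update_add, smul_add, Finsupp.sum_add,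
    Finset.sum_add_distrib]

/-- The bridge between identity and pseudo-identity: every value of `f` on elements `a(x)` is an
image of `f^*`. -/
theorem lift_toFree_coeff (f : MultilinearPoly k n) (x : Fin n → k[T;T⁻¹]) (a : Fin n → C) :
    FreeNonUnitalNonAssocAlgebra.lift k (fun i => coeff (x i) (a i)) f.toFree
      = coeffPairing x (f.star a) := by
  rw [lift_toFree, star, map_sum]
  refine Finset.sum_congr rfl fun σ _ => ?_
  rw [coeffPairing_permMap, Finsupp.sum, Finsupp.sum, map_sum]
  refine Finset.sum_congr rfl fun m _ => ?_
  rw [coeffPairing_smul, ← Bracketing.eval_coeff]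

end MultilinearPoly

/-- A function that is additive in each variable vanishes as soon as it vanishes on families of
elements `a(x)`. -/
theorem eq_zero_of_update_add {ι P : Type*} [Fintype ι] [DecidableEq ι] [AddCommGroup P]
    (Φ : (ι → Coeff k C) → P)
    (hadd : ∀ u i x y, Φ (Function.update u i (x + y))
      = Φ (Function.update u i x) + Φ (Function.update u i y))
    (h : ∀ (x : ι → k[T;T⁻¹]) (a : ι → C), Φ (fun i => coeff (x i) (a i)) = 0)
    (u : ι → Coeff k C) : Φ u = 0 := by
  -- Induction on the set `s` of positions where the entry may be arbitrary; all other entries are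
  -- of the form `a(x)`.
  suffices H : ∀ s : Finset ι, ∀ u : ι → Coeff k C,
      (∀ i ∉ s, ∃ x a, u i = coeff x a) → Φ u = 0 from
    H Finset.univ u fun i hi => absurd (Finset.mem_univ i) hi
  intro s
  induction s using Finset.induction_on with
  | empty =>
    intro u hu
    choose x a hxa using fun i => hu i (Finset.notMem_empty i)
    rw [funext hxa]
    exact h x a
  | insert j s hj ih =>
    intro u hu
    -- Writing the `j`-th entry as an update lets the induction on `u j` vary that entry alone.
    rw [← Function.update_eq_self j u]
    induction u j using coeff_induction with
    -- Additivity for `0 + 0` in position `j` forces the value to be zero.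
    | h0 => simpa using hadd u j 0 0
    | h2 v w hv hw => rw [hadd, hv, hw, add_zero]
    | h1 x a =>
      -- With its `j`-th entry now of the form `a(x)`, the family is arbitrary only on `s`.
      refine ih _ fun i hi => ?_
      by_cases hij : i = j
      · subst hij
        exact ⟨x, a, Function.update_self _ _ _⟩
      · rw [Function.update_of_ne hij]
        exact hu i (by simp [hij, hi])

end Eval

end ConformalAlgebra

theorem mainTheorem2 {k C : Type*} [Field k] [CharZero k] [AddCommGroup C] [Module k C]
    [Module k[X] C] [IsScalarTower k k[X] C] [ConformalAlgebra k C] {n : ℕ}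
    (f : ConformalAlgebra.MultilinearPoly k n) (hf : f.IsPseudoIdentity C) :
    f.IsIdentity (ConformalAlgebra.Coeff k C) :=
  ConformalAlgebra.eq_zero_of_update_add (k := k)
    (fun u => FreeNonUnitalNonAssocAlgebra.lift k u f.toFree) f.lift_toFree_update_add
    fun x a => by rw [ConformalAlgebra.MultilinearPoly.lift_toFree_coeff, hf a, map_zero]
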